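/- For complex numbers $a,q$ and an integer $m\ge 0$ put $(a;q)_m=\prod_{j=0}^{m-1}(1-aq^j)$, and for $|q|<1$ put $(a;q)_\infty=\prod_{j=0}^{\infty}(1-aq^j)$ and $(a,b,c;q)_\infty=(a;q)_\infty(b;q)_\infty(c;q)_\infty$. Then for every complex $q$ with $|q|<1$ the following three double series converge absolutely and $$\sum_{n,r\ge 0}\frac{(-1)^n q^{\frac52 n^2+4nr+2r^2+\frac32 n+2r}\,(q;q)_{2n+3r+1}(q;q)_{n+2r+1}(q;q)_{n+r}}{(q^3;q^3)_{n+r}(q;q)_n(q;q)_r(q^3;q^3)_{n+2r+1}(q;q)_{2n+2r+1}}=\frac{(q,q^6,q^7;q^7)_\infty}{(q^3;q^3)_\infty},$$ $$1-\sum_{n,r\ge 0}\frac{(-1)^n q^{\frac52 n^2+4nr+2r^2+\frac92 n+5r+2}\,(q;q)_{2n+3r+1}(q;q)_{n+r+1}(q;q)_{n+2r+1}(1+q^{n+r+1})}{(q^3;q^3)_{n+r+1}(q;q)_n(q;q)_r(q^3;q^3)_{n+2r+1}(q;q)_{2n+2r+2}}=\frac{(q^2,q^5,q^7;q^7)_\infty}{(q^3;q^3)_\infty},$$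 $$\sum_{n,r\ge 0}\frac{(-1)^n q^{\frac52 n^2+4nr+2r^2-\frac12 n}\,(q;q)_{2n+3r}(q;q)_{n+2r}(q;q)_{n+r}}{(q;q)_{2n+2r}(q;q)_n(q;q)_r(q^3;q^3)_{n+2r}(q^3;q^3)_{n+r}}=\frac{(q^3,q^4,q^7;q^7)_\infty}{(q^3;q^3)_\infty}.$$ -/

import Mathlib

/-- The finite `q`-shifted factorial `(a; q)_m = ∏_{j=0}^{m-1} (1 - a q^j)`. -/
noncomputable def qPoch (a q : ℂ) (m : ℕ) : ℂ :=
  ∏ j ∈ Finset.range m, (1 - a * q ^ j)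

/-- The infinite `q`-shifted factorial `(a; q)_∞ = ∏_{j=0}^∞ (1 - a q^j)`, for `|q| < 1`. -/
noncomputable def qPochInf (a q : ℂ) : ℂ :=
  ∏' j : ℕ, (1 - a * q ^ j)

/-- The infinite product defining `(a; q)_∞` converges for `|q| < 1`,
so its value is the genuine one. -/
theorem multipliable_qPochInf (a : ℂ) {q : ℂ} (hq : ‖q‖ < 1) :
    Multipliable fun j : ℕ => 1 - a * q ^ j := by
  have h : Summable fun j : ℕ => ‖-(a * q ^ j)‖ := by
    simp only [norm_neg, norm_mul, norm_pow]
    exact (summable_geometric_of_lt_one (norm_nonneg q) hq).mul_left _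
  simpa [sub_eq_add_neg] using multipliable_one_add_of_summable h

/-- The abbreviation `(a, b, c; q)_∞ = (a; q)_∞ (b; q)_∞ (c; q)_∞`. -/
noncomputable def qPochInf₃ (a b c q : ℂ) : ℂ :=
  qPochInf a q * qPochInf b q * qPochInf c q

/-- The summand of the first double sum, with exponent `(5/2)n² + 4nr + 2r² + (3/2)n + 2r`
(the division by 2 is exact). -/
noncomputable def summand₁ (q : ℂ) (n r : ℕ) : ℂ :=
  ((-1) ^ n * q ^ ((5 * n ^ 2 + 3 * n) / 2 + 4 * n * r + 2 * r ^ 2 + 2 * r) *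
      qPoch q q (2 * n + 3 * r + 1) * qPoch q q (n + 2 * r + 1) * qPoch q q (n + r)) /
    (qPoch (q ^ 3) (q ^ 3) (n + r) * qPoch q q n * qPoch q q r *
      qPoch (q ^ 3) (q ^ 3) (n + 2 * r + 1) * qPoch q q (2 * n + 2 * r + 1))

/-- The summand of the second double sum, with exponent
`(5/2)n² + 4nr + 2r² + (9/2)n + 5r + 2` (the division by 2 is exact). -/
noncomputable def summand₂ (q : ℂ) (n r : ℕ) : ℂ :=
  ((-1) ^ n * q ^ ((5 * n ^ 2 + 9 * n) / 2 + 4 * n * r + 2 * r ^ 2 + 5 * r + 2) *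
      qPoch q q (2 * n + 3 * r + 1) * qPoch q q (n + r + 1) * qPoch q q (n + 2 * r + 1) *
      (1 + q ^ (n + r + 1))) /
    (qPoch (q ^ 3) (q ^ 3) (n + r + 1) * qPoch q q n * qPoch q q r *
      qPoch (q ^ 3) (q ^ 3) (n + 2 * r + 1) * qPoch q q (2 * n + 2 * r + 2))

/-- The summand of the third double sum, with exponent `(5/2)n² + 4nr + 2r² - (1/2)n`
(the subtraction never truncates and the division by 2 is exact). -/
noncomputable def summand₃ (q : ℂ) (n r : ℕ) : ℂ :=
  ((-1) ^ n * q ^ ((5 * n ^ 2 - n) / 2 + 4 * n * r + 2 * r ^ 2) *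
      qPoch q q (2 * n + 3 * r) * qPoch q q (n + 2 * r) * qPoch q q (n + r)) /
    (qPoch q q (2 * n + 2 * r) * qPoch q q n * qPoch q q r *
      qPoch (q ^ 3) (q ^ 3) (n + 2 * r) * qPoch (q ^ 3) (q ^ 3) (n + r))

/-!
The factors `(q; q)_m / (q³; q³)_m` satisfy a recurrence with characteristic polynomial
`1 + x + x²`, whose roots are primitive cube roots of unity; these are the numerator parameters of a
`q`-Pfaff–Saalschütz sum. Expanding the Bailey kernel in base `q` with it and using the unit Bailey
pair gives a very-well-poised sum, and a `q`-binomial sum over `n + r = N` then turns the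
inner sum into `∑ⱼ (-1)^j q^{j(j-1)/2} / ((q³; q³)_{N-j} (q³; q³)_{N+d+j})`, where `d = 1` for the
first identity and `d = 0` for the third. The limiting case of Bailey's lemma in base `q³` sums
over `N`, leaving a theta series in base `q⁷` for the Jacobi triple product.

The second summand is the first one times a function of `n + r`. The reflection `j ↦ -1 - j` and a
recurrence of the kernel rewrite its inner sum as minus the `(N + 1)`-st inner sum of the theta
coefficients `(-1)^j q^{j(j-1)/2 + 2j}`, and the leading `1` supplies the term `N = 0`.
-/

open Filter Finset Topology

section QPochhammer

variable {q : ℂ}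

theorem norm_pow_lt_one {𝕜 : Type*} [NormedDivisionRing 𝕜] {q : 𝕜} (hq : ‖q‖ < 1) {k : ℕ}
    (hk : k ≠ 0) : ‖q ^ k‖ < 1 := by
  rw [norm_pow]
  exact pow_lt_one₀ (norm_nonneg q) hq hk

theorem one_sub_pow_succ_ne_zero {𝕜 : Type*} [NormedDivisionRing 𝕜] {q : 𝕜} (hq : ‖q‖ < 1)
    (n : ℕ) : 1 - q ^ (n + 1) ≠ 0 := by
  intro h
  have hlt := norm_pow_lt_one hq n.succ_ne_zero
  rw [← sub_eq_zero.mp h, norm_one] at hlt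
  exact lt_irrefl _ hlt

theorem qPoch_zero (a q : ℂ) : qPoch a q 0 = 1 := by simp [qPoch]

theorem qPoch_succ (a q : ℂ) (n : ℕ) : qPoch a q (n + 1) = qPoch a q n * (1 - a * q ^ n) :=
  prod_range_succ _ _

theorem qPoch_self_succ (q : ℂ) (n : ℕ) :
    qPoch q q (n + 1) = qPoch q q n * (1 - q ^ (n + 1)) := by
  rw [qPoch_succ, pow_succ' q n]

theorem qPoch_self_ne_zero (hq : ‖q‖ < 1) (n : ℕ) : qPoch q q n ≠ 0 := by
  refine prod_ne_zero_iff.mpr fun j _ => ?_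
  rw [← pow_succ']
  exact one_sub_pow_succ_ne_zero hq j

theorem tendsto_qPoch (a : ℂ) (hq : ‖q‖ < 1) : Tendsto (qPoch a q) atTop (𝓝 (qPochInf a q)) :=
  (multipliable_qPochInf a hq).hasProd.tendsto_prod_nat

theorem exists_norm_qPoch_le (a : ℂ) (hq : ‖q‖ < 1) : ∃ C : ℝ, ∀ n, ‖qPoch a q n‖ ≤ C := by
  obtain ⟨C, -, hC⟩ := (Metric.isBounded_range_of_tendsto _ (tendsto_qPoch a hq)).exists_pos_norm_le
  exact ⟨C, fun n => hC _ ⟨n, rfl⟩⟩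

theorem qPochInf_self_ne_zero (hq : ‖q‖ < 1) : qPochInf q q ≠ 0 := by
  have h := tprod_one_add_ne_zero_of_summable (f := fun n : ℕ => -(q * q ^ n)) ?_ ?_
  · simpa [qPochInf, sub_eq_add_neg] using h
  · intro n
    have := one_sub_pow_succ_ne_zero hq n
    rwa [pow_succ', sub_eq_add_neg] at this
  · simp only [norm_neg, norm_mul, norm_pow]
    exact (summable_geometric_of_lt_one (norm_nonneg q) hq).mul_left _

theorem qPochInf_zero_left (q : ℂ) : qPochInf 0 q = 1 := by simp [qPochInf]

/-- The reciprocal `1 / (q; q)_m`, extended by zero to negative integers `m`; this convention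
makes sums over intervals into sums over all of `ℤ`. -/
noncomputable def qPochInv (q : ℂ) (m : ℤ) : ℂ :=
  if 0 ≤ m then (qPoch q q m.toNat)⁻¹ else 0

theorem qPochInv_natCast (q : ℂ) (n : ℕ) : qPochInv q n = (qPoch q q n)⁻¹ := by simp [qPochInv]

theorem qPochInv_zero (q : ℂ) : qPochInv q 0 = 1 := by simp [qPochInv, qPoch]

theorem qPochInv_of_neg (q : ℂ) {m : ℤ} (hm : m < 0) : qPochInv q m = 0 := by
  simp [qPochInv, not_le.mpr hm]

theorem one_sub_zpow_mul_qPochInv (hq : ‖q‖ < 1) (m : ℤ) :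
    (1 - q ^ m) * qPochInv q m = qPochInv q (m - 1) := by
  rcases lt_trichotomy m 0 with hm | rfl | hm
  · rw [qPochInv_of_neg q hm, qPochInv_of_neg q (by omega), mul_zero]
  · rw [qPochInv_of_neg q (by norm_num : (0 : ℤ) - 1 < 0)]
    simp
  · obtain ⟨n, rfl⟩ : ∃ n : ℕ, m = ((n + 1 : ℕ) : ℤ) := ⟨m.toNat - 1, by omega⟩
    rw [show (((n + 1 : ℕ) : ℤ) - 1) = (n : ℤ) by push_cast; ring, qPochInv_natCast,
      qPochInv_natCast, zpow_natCast, qPoch_self_succ]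
    have := one_sub_pow_succ_ne_zero hq n
    have := qPoch_self_ne_zero hq n
    field_simp

theorem tendsto_qPochInv (hq : ‖q‖ < 1) :
    Tendsto (fun n : ℕ => qPochInv q n) atTop (𝓝 (qPochInf q q)⁻¹) := by
  simp only [qPochInv_natCast]
  exact (tendsto_qPoch q hq).inv₀ (qPochInf_self_ne_zero hq)

theorem tendsto_qPochInv_add (hq : ‖q‖ < 1) (k : ℤ) :
    Tendsto (fun n : ℕ => qPochInv q (n + k)) atTop (𝓝 (qPochInf q q)⁻¹) := by
  have h : Tendsto (fun n : ℕ => ((n : ℤ) + k).toNat) atTop atTop := by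
    refine tendsto_atTop.mpr fun b => ?_
    filter_upwards [eventually_ge_atTop (b + k.natAbs)] with n hn
    omega
  refine ((tendsto_qPochInv hq).comp h).congr' ?_
  filter_upwards [eventually_ge_atTop k.natAbs] with n hn
  rw [Function.comp_apply, Int.toNat_of_nonneg (by omega)]

theorem exists_norm_qPochInv_le (hq : ‖q‖ < 1) : ∃ C : ℝ, ∀ m, ‖qPochInv q m‖ ≤ C := by
  obtain ⟨C, hC0, hC⟩ :=
    (Metric.isBounded_range_of_tendsto _ (tendsto_qPochInv hq)).exists_pos_norm_le
  refine ⟨C, fun m => ?_⟩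
  rcases lt_or_ge m 0 with hm | hm
  · rw [qPochInv_of_neg q hm, norm_zero]
    exact hC0.le
  · lift m to ℕ using hm
    exact hC _ ⟨m, rfl⟩

end QPochhammer

section BaileyKernel

/-- The kernel `1 / ((p; p)_{a-j} (p; p)_{b+j})` through which Bailey pairs are defined. -/
noncomputable def baileyKernel (p : ℂ) (a b j : ℤ) : ℂ := qPochInv p (a - j) * qPochInv p (b + j)

theorem baileyKernel_neg (p : ℂ) (a b j : ℤ) : baileyKernel p a b (-j) = baileyKernel p b a j := by
  rw [baileyKernel, baileyKernel, sub_neg_eq_add, ← sub_eq_add_neg, mul_comm]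

theorem baileyKernel_add_one_sub_one (p : ℂ) (a b j : ℤ) :
    baileyKernel p (a + 1) (b - 1) (j + 1) = baileyKernel p a b j := by
  rw [baileyKernel, baileyKernel, add_sub_add_right_eq_sub,
    show b - 1 + (j + 1) = b + j by ring]

theorem baileyKernel_eq_zero (p : ℂ) {a b j : ℤ} (h : a < j ∨ j < -b) :
    baileyKernel p a b j = 0 := by
  rcases h with h | h
  · rw [baileyKernel, qPochInv_of_neg p (by omega : a - j < 0), zero_mul]
  · rw [baileyKernel, qPochInv_of_neg p (by omega : b + j < 0), mul_zero]

theorem summable_mul_baileyKernel (p : ℂ) (w : ℤ → ℂ) (a b : ℤ) :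
    Summable fun j : ℤ => w j * baileyKernel p a b j := by
  refine summable_of_ne_finset_zero (s := Icc (-b) a) fun j hj => ?_
  rw [mem_Icc] at hj
  rw [baileyKernel_eq_zero p (by omega), mul_zero]

theorem tsum_mul_baileyKernel_zero (p : ℂ) (w : ℤ → ℂ) :
    ∑' j : ℤ, w j * baileyKernel p 0 0 j = w 0 := by
  rw [tsum_eq_single 0 fun j hj => by rw [baileyKernel_eq_zero p (by omega), mul_zero]]
  simp [baileyKernel, qPochInv_zero]

theorem tsum_mul_baileyKernel_of_add_neg (p : ℂ) (w : ℤ → ℂ) {a b : ℤ} (h : a + b < 0) :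
    ∑' j : ℤ, w j * baileyKernel p a b j = 0 := by
  refine (tsum_congr fun j => ?_).trans tsum_zero
  rw [baileyKernel_eq_zero p (by omega), mul_zero]

variable {p : ℂ}

theorem one_sub_zpow_mul_baileyKernel (h0 : p ≠ 0) (hp : ‖p‖ < 1) (a b j : ℤ) :
    (1 - p ^ (a + b)) * baileyKernel p a b j =
      baileyKernel p (a - 1) b j + p ^ (a - j) * baileyKernel p a (b - 1) j := by
  have hpow : p ^ (a + b) = p ^ (a - j) * p ^ (b + j) := by
    rw [← zpow_add₀ h0]
    congr 1
    ring
  simp only [baileyKernel]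
  rw [hpow, sub_right_comm, sub_add_eq_add_sub, ← one_sub_zpow_mul_qPochInv hp (a - j),
    ← one_sub_zpow_mul_qPochInv hp (b + j)]
  ring

theorem exists_norm_baileyKernel_le (hp : ‖p‖ < 1) :
    ∃ C : ℝ, ∀ a b j, ‖baileyKernel p a b j‖ ≤ C := by
  obtain ⟨C, hC⟩ := exists_norm_qPochInv_le hp
  refine ⟨C * C, fun a b j => ?_⟩
  rw [baileyKernel, norm_mul]
  exact mul_le_mul (hC _) (hC _) (norm_nonneg _) ((norm_nonneg _).trans (hC 0))

theorem tendsto_baileyKernel (hp : ‖p‖ < 1) (d j : ℤ) :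
    Tendsto (fun M : ℕ => baileyKernel p M (M + d) j) atTop
      (𝓝 ((qPochInf p p)⁻¹ * (qPochInf p p)⁻¹)) := by
  have h₁ := tendsto_qPochInv_add hp (-j)
  have h₂ := tendsto_qPochInv_add hp (d + j)
  simpa only [baileyKernel, sub_eq_add_neg, add_assoc] using h₁.mul h₂

theorem tendsto_tsum_mul_baileyKernel (hp : ‖p‖ < 1) (d : ℤ) {w : ℤ → ℂ}
    (hw : Summable fun j => ‖w j‖) :
    Tendsto (fun M : ℕ => ∑' j, w j * baileyKernel p M (M + d) j) atTop
      (𝓝 ((∑' j, w j) * ((qPochInf p p)⁻¹ * (qPochInf p p)⁻¹))) := by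
  obtain ⟨C, hC⟩ := exists_norm_baileyKernel_le hp
  rw [← tsum_mul_right]
  refine tendsto_tsum_of_dominated_convergence (hw.mul_right C)
    (fun j => (tendsto_baileyKernel hp d j).const_mul _) (.of_forall fun M j => ?_)
  rw [norm_mul]
  exact mul_le_mul_of_nonneg_left (hC _ _ _) (norm_nonneg _)

end BaileyKernel

section ThetaCoeff

/-- The coefficient `(-1)^j q^{j(j-1)/2}` of `x^j` in the theta series of the Jacobi triple
product. -/
noncomputable def thetaCoeff (q : ℂ) (j : ℤ) : ℂ := (-1) ^ j * q ^ (j * (j - 1) / 2)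

theorem two_mul_mul_sub_one_ediv_two (j : ℤ) : 2 * (j * (j - 1) / 2) = j * (j - 1) :=
  Int.mul_ediv_cancel' (Int.even_mul_pred_self j).two_dvd

theorem mul_sub_one_ediv_two_nonneg (j : ℤ) : 0 ≤ j * (j - 1) / 2 := by
  have : 0 ≤ j * (j - 1) := by
    rcases le_or_gt j 0 with h | h <;> nlinarith
  omega

theorem thetaCoeff_zero (q : ℂ) : thetaCoeff q 0 = 1 := by simp [thetaCoeff]

theorem norm_thetaCoeff_le_one {q : ℂ} (hq : ‖q‖ < 1) (j : ℤ) : ‖thetaCoeff q j‖ ≤ 1 := by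
  obtain ⟨k, hk⟩ := Int.eq_ofNat_of_zero_le (mul_sub_one_ediv_two_nonneg j)
  rw [thetaCoeff, hk, zpow_natCast, norm_mul, norm_zpow, norm_neg, norm_one, one_zpow, one_mul,
    norm_pow]
  exact pow_le_one₀ (norm_nonneg q) hq.le

variable {q : ℂ}

theorem thetaCoeff_ne_zero (h0 : q ≠ 0) (j : ℤ) : thetaCoeff q j ≠ 0 :=
  mul_ne_zero (zpow_ne_zero _ (by norm_num)) (zpow_ne_zero _ h0)

theorem thetaCoeff_add_one (h0 : q ≠ 0) (j : ℤ) :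
    thetaCoeff q (j + 1) = -q ^ j * thetaCoeff q j := by
  have h : (j + 1) * (j + 1 - 1) / 2 = j + j * (j - 1) / 2 := by
    rw [show (j + 1) * (j + 1 - 1) = j * (j - 1) + j * 2 by ring,
      Int.add_mul_ediv_right _ _ two_ne_zero, add_comm]
  rw [thetaCoeff, thetaCoeff, h, zpow_add₀ h0, zpow_add₀ (by norm_num), zpow_one]
  ring

theorem thetaCoeff_neg (h0 : q ≠ 0) (j : ℤ) : thetaCoeff q (-j) = q ^ j * thetaCoeff q j := by
  have h : -j * (-j - 1) / 2 = j + j * (j - 1) / 2 := by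
    rw [show -j * (-j - 1) = j * (j - 1) + j * 2 by ring,
      Int.add_mul_ediv_right _ _ two_ne_zero, add_comm]
  rw [thetaCoeff, thetaCoeff, h, zpow_add₀ h0, zpow_neg, ← inv_zpow, inv_neg, inv_one]
  ring

theorem thetaCoeff_pow_two_mul_add_one (h0 : q ≠ 0) (m : ℕ) (j : ℤ) :
    thetaCoeff (q ^ (2 * m + 1)) j = thetaCoeff q j * q ^ (m * (j * j - j)) := by
  rw [thetaCoeff, thetaCoeff, mul_assoc, ← zpow_natCast, ← zpow_mul, ← zpow_add₀ h0]
  congr 2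
  push_cast
  linear_combination (m : ℤ) * two_mul_mul_sub_one_ediv_two j

theorem summable_norm_thetaCoeff_mul_pow {x : ℂ} (h0 : q ≠ 0) (hq : ‖q‖ < 1) (hx : x ≠ 0) :
    Summable fun n : ℕ => ‖thetaCoeff q n * x ^ n‖ := by
  have hne (n : ℕ) : ‖thetaCoeff q n * x ^ n‖ ≠ 0 :=
    norm_ne_zero_iff.mpr (mul_ne_zero (thetaCoeff_ne_zero h0 n) (pow_ne_zero n hx))
  refine summable_of_ratio_test_tendsto_lt_one (l := 0) zero_lt_one (.of_forall hne) ?_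
  have hlim : Tendsto (fun n : ℕ => ‖q‖ ^ n * ‖x‖) atTop (𝓝 0) := by
    simpa using (tendsto_pow_atTop_nhds_zero_of_lt_one (norm_nonneg q) hq).mul_const ‖x‖
  refine hlim.congr fun n => ?_
  rw [norm_norm, norm_norm, eq_div_iff (hne n), ← norm_pow, ← norm_mul, ← norm_mul, Nat.cast_succ,
    thetaCoeff_add_one h0, pow_succ, zpow_natCast, ← norm_neg]
  congr 1
  ring

theorem summable_norm_thetaCoeff_mul_zpow {x : ℂ} (h0 : q ≠ 0) (hq : ‖q‖ < 1) (hx : x ≠ 0) :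
    Summable fun j : ℤ => ‖thetaCoeff q j * x ^ j‖ := by
  refine Summable.of_nat_of_neg (by simpa using summable_norm_thetaCoeff_mul_pow h0 hq hx) ?_
  refine (summable_norm_thetaCoeff_mul_pow h0 hq (div_ne_zero h0 hx)).congr fun n => ?_
  rw [thetaCoeff_neg h0, zpow_neg, zpow_natCast, zpow_natCast, div_pow]
  congr 1
  ring

end ThetaCoeff

section JacobiTripleProduct

variable {p x : ℂ}

/-- The theta series `∑ⱼ (-1)^j p^{j(j-1)/2} x^j` truncated to `-b ≤ j ≤ a` by the Bailey
kernel. -/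
noncomputable def truncTheta (p x : ℂ) (a b : ℤ) : ℂ :=
  ∑' j : ℤ, thetaCoeff p j * x ^ j * baileyKernel p a b j

theorem truncTheta_zero (p x : ℂ) : truncTheta p x 0 0 = 1 := by
  rw [truncTheta, tsum_mul_baileyKernel_zero, thetaCoeff_zero, zpow_zero, mul_one]

theorem truncTheta_comm (h0 : p ≠ 0) (a b : ℤ) :
    truncTheta p x a b = truncTheta p (p / x) b a := by
  rw [truncTheta, ← (Equiv.neg ℤ).tsum_eq]
  refine tsum_congr fun j => ?_
  rw [Equiv.neg_apply, baileyKernel_neg, thetaCoeff_neg h0, div_zpow, zpow_neg, div_eq_mul_inv]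
  ring

theorem truncTheta_add_one (h0 : p ≠ 0) (hp : ‖p‖ < 1) (hx : x ≠ 0) (a b : ℤ) :
    (1 - p ^ (a + b + 1)) * truncTheta p x (a + 1) b = (1 - x * p ^ a) * truncTheta p x a b := by
  set f : ℤ → ℂ := fun j => thetaCoeff p j * x ^ j * baileyKernel p a b j with hf
  set g : ℤ → ℂ := fun j => thetaCoeff p j * x ^ j * baileyKernel p (a + 1) b j with hg
  have hfs : Summable f := summable_mul_baileyKernel p _ a b
  have hfs' : Summable fun j => f (j + 1) := (Equiv.addRight (1 : ℤ)).summable_iff.mpr hfs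
  have hfg (j : ℤ) : (1 - p ^ (a + b + 1)) * g (j + 1) = f (j + 1) + -(x * p ^ a) * f j := by
    have hK := one_sub_zpow_mul_baileyKernel h0 hp (a + 1) b (j + 1)
    rw [show a + 1 + b = a + b + 1 by ring, add_sub_cancel_right, add_sub_add_right_eq_sub,
      baileyKernel_add_one_sub_one, zpow_sub₀ h0] at hK
    have hj : p ^ j ≠ 0 := zpow_ne_zero _ h0
    simp only [hf, hg]
    rw [mul_left_comm, hK, thetaCoeff_add_one h0, zpow_add_one₀ hx]
    field_simp
    ring
  calc (1 - p ^ (a + b + 1)) * truncTheta p x (a + 1) b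
      = ∑' j, (1 - p ^ (a + b + 1)) * g (j + 1) := by
        rw [tsum_mul_left, truncTheta, ← (Equiv.addRight (1 : ℤ)).tsum_eq]; rfl
    _ = ∑' j, f (j + 1) + -(x * p ^ a) * ∑' j, f j := by
        rw [tsum_congr hfg, hfs'.tsum_add (hfs.mul_left _), tsum_mul_left]
    _ = (1 - x * p ^ a) * truncTheta p x a b := by
        rw [show ∑' j, f (j + 1) = ∑' j, f j from (Equiv.addRight (1 : ℤ)).tsum_eq f, truncTheta]
        ring

theorem qPoch_mul_truncTheta (h0 : p ≠ 0) (hp : ‖p‖ < 1) (hx : x ≠ 0) (a b : ℕ) :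
    qPoch p p (a + b) * truncTheta p x a b = qPoch x p a * qPoch (p / x) p b := by
  have of_zero {x : ℂ} (hx : x ≠ 0) (b : ℕ)
      (hb : qPoch p p b * truncTheta p x 0 b = qPoch (p / x) p b) (a : ℕ) :
      qPoch p p (a + b) * truncTheta p x a b = qPoch x p a * qPoch (p / x) p b := by
    induction a with
    | zero => simpa [qPoch_zero] using hb
    | succ a ih =>
      have h := truncTheta_add_one h0 hp hx a b
      rw [show (a : ℤ) + b + 1 = (a + b + 1 : ℕ) by push_cast; ring, zpow_natCast,
        zpow_natCast] at h
      rw [show a + 1 + b = a + b + 1 by ring, qPoch_self_succ, qPoch_succ, Nat.cast_succ, mul_assoc,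
        h, mul_left_comm, ih]
      ring
  refine of_zero hx b ?_ a
  have h := of_zero (div_ne_zero h0 hx) 0 (by simp [qPoch_zero, truncTheta_zero]) b
  simpa [qPoch_zero, truncTheta_comm h0 0 b] using h

theorem tsum_thetaCoeff_mul_zpow (h0 : p ≠ 0) (hp : ‖p‖ < 1) (hx : x ≠ 0) :
    ∑' j : ℤ, thetaCoeff p j * x ^ j = qPochInf x p * qPochInf (p / x) p * qPochInf p p := by
  have hP := qPochInf_self_ne_zero hp
  have hlim := tendsto_tsum_mul_baileyKernel hp 0 (summable_norm_thetaCoeff_mul_zpow h0 hp hx)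
  simp only [add_zero] at hlim
  have hdouble : Tendsto (fun N : ℕ => N + N) atTop atTop := tendsto_atTop_mono (by simp) tendsto_id
  have h := tendsto_nhds_unique (((tendsto_qPoch p hp).comp hdouble).mul hlim)
    (((tendsto_qPoch x hp).mul (tendsto_qPoch (p / x) hp)).congr fun N =>
      (qPoch_mul_truncTheta h0 hp hx N N).symm)
  rw [← h]
  field_simp

theorem tsum_thetaCoeff_mul_baileyKernel (h0 : p ≠ 0) (hp : ‖p‖ < 1) {d : ℕ} (hd : d ≤ 1) (k : ℤ) :
    ∑' j : ℤ, thetaCoeff p j * baileyKernel p k (k + d) j = if k = 0 then 1 else 0 := by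
  rcases lt_or_ge k 0 with hk | hk
  · rw [tsum_mul_baileyKernel_of_add_neg p _ (by omega), if_neg hk.ne]
  · lift k to ℕ using hk
    have h := qPoch_mul_truncTheta h0 hp one_ne_zero k (k + d)
    simp only [truncTheta, one_zpow, mul_one, div_one, Nat.cast_add] at h
    refine mul_left_cancel₀ (qPoch_self_ne_zero hp (k + (k + d))) (h.trans ?_)
    cases k with
    | zero => simp [qPoch_zero]
    | succ k => simp [qPoch, prod_range_succ', Nat.cast_add_one_ne_zero]

end JacobiTripleProduct

section PfaffSaalschutz

variable {q : ℂ}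

/-- The coefficient `q^{(A-v)(B-v)} / ((q; q)_v (q; q)_{A-v} (q; q)_{B-v})` of the
`q`-Vandermonde sum. -/
noncomputable def vandermondeCoeff (q : ℂ) (A B v : ℤ) : ℂ :=
  q ^ ((A - v) * (B - v)) * (qPochInv q v * qPochInv q (A - v) * qPochInv q (B - v))

theorem vandermondeCoeff_comm (q : ℂ) (A B v : ℤ) :
    vandermondeCoeff q A B v = vandermondeCoeff q B A v := by
  rw [vandermondeCoeff, vandermondeCoeff, mul_comm (A - v), mul_right_comm (qPochInv q v)]

theorem vandermondeCoeff_eq_zero (q : ℂ) {A v : ℤ} (h : v < 0 ∨ A < v) (B : ℤ) :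
    vandermondeCoeff q A B v = 0 := by
  rcases h with h | h
  · simp [vandermondeCoeff, qPochInv_of_neg q h]
  · simp [vandermondeCoeff, qPochInv_of_neg q (by omega : A - v < 0)]

theorem summable_vandermondeCoeff_mul (q : ℂ) (A B : ℤ) (w : ℤ → ℂ) :
    Summable fun v : ℤ => vandermondeCoeff q A B v * w v := by
  refine summable_of_ne_finset_zero (s := Icc 0 A) fun v hv => ?_
  rw [mem_Icc] at hv
  rw [vandermondeCoeff_eq_zero q (by omega), zero_mul]

theorem vandermondeCoeff_add_one (h0 : q ≠ 0) (hq : ‖q‖ < 1) (A B v : ℤ) :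
    (1 - q ^ (A + 1)) * (1 - q ^ (B + 1)) * vandermondeCoeff q (A + 1) (B + 1) v =
      q ^ (A + B + 1 - v) * vandermondeCoeff q A B v +
        (1 - q ^ (A + B + 2 - v)) * vandermondeCoeff q A B (v - 1) := by
  have hv := one_sub_zpow_mul_qPochInv hq v
  have hA := one_sub_zpow_mul_qPochInv hq (A + 1 - v)
  have hB := one_sub_zpow_mul_qPochInv hq (B + 1 - v)
  have hpow : q ^ v * q ^ ((A + 1 - v) * (B + 1 - v)) =
      q ^ (A + B + 1 - v) * q ^ ((A - v) * (B - v)) := by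
    rw [← zpow_add₀ h0, ← zpow_add₀ h0]
    congr 1
    ring
  have hA' : q ^ (A + 1) = q ^ v * q ^ (A + 1 - v) := by rw [← zpow_add₀ h0]; congr 1; ring
  have hB' : q ^ (B + 1) = q ^ v * q ^ (B + 1 - v) := by rw [← zpow_add₀ h0]; congr 1; ring
  have hAB : q ^ (A + B + 2 - v) = q ^ v * q ^ (A + 1 - v) * q ^ (B + 1 - v) := by
    rw [← zpow_add₀ h0, ← zpow_add₀ h0]; congr 1; ring
  have hsplit : (1 - q ^ (A + 1)) * (1 - q ^ (B + 1)) =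
      q ^ v * ((1 - q ^ (A + 1 - v)) * (1 - q ^ (B + 1 - v))) +
        (1 - q ^ (A + B + 2 - v)) * (1 - q ^ v) := by
    rw [hA', hB', hAB]; ring
  rw [hsplit, vandermondeCoeff, vandermondeCoeff, vandermondeCoeff, ← hv,
    show A - (v - 1) = A + 1 - v by ring, show B - (v - 1) = B + 1 - v by ring,
    show A - v = A + 1 - v - 1 by ring, show B - v = B + 1 - v - 1 by ring, ← hA, ← hB,
    ← mul_assoc (q ^ (A + B + 1 - v)), show A + 1 - v - 1 = A - v by ring,
    show B + 1 - v - 1 = B - v by ring, ← hpow]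
  ring

/-- The `q`-Vandermonde sum `∑ᵥ q^{(A-v)(B-v)} w v / ((q; q)_v (q; q)_{A-v} (q; q)_{B-v})` with a
weight `w`; suitable weights turn it into the `q`-Pfaff–Saalschütz sum. -/
noncomputable def vandermondeSum (q : ℂ) (w : ℤ → ℂ) (A B : ℤ) : ℂ :=
  ∑' v : ℤ, vandermondeCoeff q A B v * w v

theorem vandermondeSum_comm (q : ℂ) (w : ℤ → ℂ) (A B : ℤ) :
    vandermondeSum q w A B = vandermondeSum q w B A :=
  tsum_congr fun v => by rw [vandermondeCoeff_comm]

theorem vandermondeSum_of_neg (q : ℂ) (w : ℤ → ℂ) {A : ℤ} (hA : A < 0) (B : ℤ) :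
    vandermondeSum q w A B = 0 := by
  refine (tsum_congr fun v => ?_).trans tsum_zero
  rw [vandermondeCoeff_eq_zero q (by omega), zero_mul]

theorem vandermondeSum_zero (q : ℂ) (w : ℤ → ℂ) (B : ℤ) :
    vandermondeSum q w 0 B = qPochInv q B * w 0 := by
  rw [vandermondeSum, tsum_eq_single 0 fun v hv => by
    rw [vandermondeCoeff_eq_zero q (by omega), zero_mul]]
  simp [vandermondeCoeff, qPochInv_zero]

theorem vandermondeSum_add_one (h0 : q ≠ 0) (hq : ‖q‖ < 1) (w : ℤ → ℂ) (A B : ℤ) :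
    (1 - q ^ (A + 1)) * (1 - q ^ (B + 1)) * vandermondeSum q w (A + 1) (B + 1) =
      vandermondeSum q
        (fun v => q ^ (A + B + 1 - v) * w v + (1 - q ^ (A + B + 1 - v)) * w (v + 1)) A B := by
  set f : ℤ → ℂ := fun v => vandermondeCoeff q A B v * (q ^ (A + B + 1 - v) * w v) with hf
  set g : ℤ → ℂ := fun v =>
    vandermondeCoeff q A B v * ((1 - q ^ (A + B + 1 - v)) * w (v + 1)) with hg
  have hfs : Summable f := summable_vandermondeCoeff_mul q A B _
  have hgs : Summable g := summable_vandermondeCoeff_mul q A B _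
  have hgs' : Summable fun v => g (v - 1) := (Equiv.subRight (1 : ℤ)).summable_iff.mpr hgs
  have hterm (v : ℤ) : (1 - q ^ (A + 1)) * (1 - q ^ (B + 1)) *
      (vandermondeCoeff q (A + 1) (B + 1) v * w v) = f v + g (v - 1) := by
    simp only [hf, hg]
    rw [← mul_assoc, vandermondeCoeff_add_one h0 hq, sub_add_cancel,
      show A + B + 1 - (v - 1) = A + B + 2 - v by ring]
    ring
  calc (1 - q ^ (A + 1)) * (1 - q ^ (B + 1)) * vandermondeSum q w (A + 1) (B + 1)
      = ∑' v, f v + ∑' v, g (v - 1) := by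
        rw [vandermondeSum, ← tsum_mul_left, tsum_congr hterm, hfs.tsum_add hgs']
    _ = ∑' v, (f v + g v) := by
        rw [hfs.tsum_add hgs, show ∑' v, g (v - 1) = ∑' v, g v from
          (Equiv.subRight (1 : ℤ)).tsum_eq g]
    _ = _ := tsum_congr fun v => by simp only [hf, hg]; ring

theorem vandermondeSum_congr (q : ℂ) {w w' : ℤ → ℂ} (h : ∀ v : ℕ, w v = w' v) (A B : ℤ) :
    vandermondeSum q w A B = vandermondeSum q w' A B := by
  refine tsum_congr fun v => ?_
  rcases lt_or_ge v 0 with hv | hv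
  · simp [vandermondeCoeff_eq_zero q (Or.inl hv)]
  · lift v to ℕ using hv
    rw [h]

theorem vandermondeSum_const_mul (q c : ℂ) (w : ℤ → ℂ) (A B : ℤ) :
    vandermondeSum q (fun v => c * w v) A B = c * vandermondeSum q w A B := by
  rw [vandermondeSum, vandermondeSum, ← tsum_mul_left]
  exact tsum_congr fun v => mul_left_comm _ _ _

theorem vandermondeSum_mul_add_one (h0 : q ≠ 0) (hq : ‖q‖ < 1)
    {c₀ c₁ c₂ : ℂ} {ρ π : ℤ → ℂ} {A B : ℕ}
    (hρ : ∀ m : ℕ, (c₀ + c₁ * q ^ (m + 1) + c₂ * (q ^ (m + 1)) ^ 2) * ρ (m + 1) = ρ m)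
    (hπ : ∀ v : ℕ, π (v + 1) = (c₀ - c₂ * q ^ (A + B + 3 + v)) * π v) :
    (1 - q ^ (A + 1)) * (1 - q ^ (B + 1)) *
        vandermondeSum q (fun v => ρ v * π v) (A + 1 : ℕ) (B + 1 : ℕ) =
      (c₀ + c₁ * q ^ (A + B + 2) + c₂ * (q ^ (A + B + 2)) ^ 2) *
        vandermondeSum q (fun v => ρ (v + 1) * π v) A B := by
  have h := vandermondeSum_add_one h0 hq (fun v => ρ v * π v) A B
  simp only [← Nat.cast_succ A, ← Nat.cast_succ B, zpow_natCast] at h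
  rw [h, ← vandermondeSum_const_mul]
  refine vandermondeSum_congr q (fun v => ?_) A B
  have hy : q ^ (A + B + 2) = q ^ ((A : ℤ) + B + 1 - v) * q ^ (v + 1) := by
    rw [← zpow_natCast q (A + B + 2), ← zpow_natCast q (v + 1), ← zpow_add₀ h0]
    congr 1
    push_cast
    ring
  have hy' : q ^ (A + B + 3 + v) = q ^ (A + B + 2) * q ^ (v + 1) := by ring
  rw [hπ, ← hρ, hy', hy]
  ring

/-- The numerator parameters of the `q`-Pfaff–Saalschütz sum enter through the quadratic
polynomial `c₀ + c₁ x + c₂ x²`, whose roots need not be rational in `q`. -/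
theorem mul_vandermondeSum_natCast_of_recurrence (h0 : q ≠ 0) (hq : ‖q‖ < 1)
    {c₀ c₁ c₂ : ℂ} {ρ π : ℤ → ℂ} (A B : ℕ)
    (hρ : ∀ m : ℕ, (c₀ + c₁ * q ^ (m + 1) + c₂ * (q ^ (m + 1)) ^ 2) * ρ (m + 1) = ρ m)
    (hπ : ∀ v : ℕ, π (v + 1) = (c₀ - c₂ * q ^ (A + B + 1 + v)) * π v) :
    ρ (A + B) * vandermondeSum q (fun v => ρ v * π v) A B =
      π 0 * (ρ A * ρ B) * (qPochInv q A * qPochInv q B) := by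
  induction A generalizing B c₁ c₂ ρ with
  | zero =>
    rw [Nat.cast_zero, vandermondeSum_zero, qPochInv_zero, zero_add]
    ring
  | succ A ih =>
    cases B with
    | zero =>
      rw [Nat.cast_zero, vandermondeSum_comm, vandermondeSum_zero, qPochInv_zero, add_zero]
      ring
    | succ B =>
      have hstep := vandermondeSum_mul_add_one h0 hq (π := π) (A := A) (B := B) hρ
        (fun v => by rw [hπ v]; ring)
      have hih := ih (c₁ := c₁ * q) (c₂ := c₂ * q ^ 2) (ρ := fun m => ρ (m + 1)) B
        (fun m => by have := hρ (m + 1); push_cast at this; rw [← this]; ring)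
        (fun v => by rw [hπ v]; ring)
      have hρy := hρ (A + B + 1)
      have hA := one_sub_zpow_mul_qPochInv hq (A + 1 : ℕ)
      have hB := one_sub_zpow_mul_qPochInv hq (B + 1 : ℕ)
      rw [zpow_natCast, Nat.cast_succ, add_sub_cancel_right] at hA hB
      refine mul_left_cancel₀ (mul_ne_zero (one_sub_pow_succ_ne_zero hq A)
        (one_sub_pow_succ_ne_zero hq B)) ?_
      rw [mul_left_comm, hstep]
      push_cast at hρy hih ⊢
      rw [← hA, ← hB, ← hρy] at hih
      rw [show (A : ℤ) + 1 + (B + 1) = A + B + 1 + 1 by ring]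
      linear_combination hih

theorem mul_vandermondeSum_of_recurrence (h0 : q ≠ 0) (hq : ‖q‖ < 1)
    {c₀ c₁ c₂ : ℂ} {ρ π : ℤ → ℂ} (A B : ℤ)
    (hρ : ∀ m : ℕ, (c₀ + c₁ * q ^ (m + 1) + c₂ * (q ^ (m + 1)) ^ 2) * ρ (m + 1) = ρ m)
    (hπ : ∀ v : ℕ, π (v + 1) = (c₀ - c₂ * q ^ (A + B + 1 + v)) * π v) :
    ρ (A + B) * vandermondeSum q (fun v => ρ v * π v) A B =
      π 0 * (ρ A * ρ B) * (qPochInv q A * qPochInv q B) := by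
  rcases lt_or_ge A 0 with hA | hA
  · rw [vandermondeSum_of_neg q _ hA, qPochInv_of_neg q hA]
    ring
  rcases lt_or_ge B 0 with hB | hB
  · rw [vandermondeSum_comm, vandermondeSum_of_neg q _ hB, qPochInv_of_neg q hB]
    ring
  lift A to ℕ using hA
  lift B to ℕ using hB
  exact mul_vandermondeSum_natCast_of_recurrence h0 hq A B hρ fun v => by rw [hπ v]; norm_cast

theorem tsum_vandermondeCoeff (h0 : q ≠ 0) (hq : ‖q‖ < 1) (A B : ℤ) :
    ∑' v : ℤ, vandermondeCoeff q A B v = qPochInv q A * qPochInv q B := by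
  simpa [vandermondeSum] using
    mul_vandermondeSum_of_recurrence h0 hq (c₀ := 1) (c₁ := 0) (c₂ := 0) (ρ := 1) (π := 1) A B
      (by simp) (by simp)

theorem tsum_thetaCoeff_mul_qPochInv (h0 : q ≠ 0) (hq : ‖q‖ < 1) (A B : ℤ) :
    ∑' v : ℤ, thetaCoeff q v * (qPochInv q v * qPochInv q (A - v) * qPochInv q (B - v)) =
      q ^ (A * B) * (qPochInv q A * qPochInv q B) := by
  have h := mul_vandermondeSum_of_recurrence h0 hq (c₀ := 0) (c₁ := 0) (c₂ := 1)
    (ρ := fun m => q ^ (-(m * (m + 1)))) (π := fun v => thetaCoeff q v * q ^ (v * (A + B + 1))) A B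
    (fun m => ?_) (fun v => ?_)
  · have hsum : vandermondeSum q
        (fun v => q ^ (-(v * (v + 1))) * (thetaCoeff q v * q ^ (v * (A + B + 1)))) A B =
        q ^ (A * B) * ∑' v : ℤ,
          thetaCoeff q v * (qPochInv q v * qPochInv q (A - v) * qPochInv q (B - v)) := by
      rw [vandermondeSum, ← tsum_mul_left]
      refine tsum_congr fun v => ?_
      rw [show A * B = (A - v) * (B - v) + -(v * (v + 1)) + v * (A + B + 1) by ring, zpow_add₀ h0,
        zpow_add₀ h0, vandermondeCoeff]
      ring
    rw [hsum, thetaCoeff_zero, zero_mul, zpow_zero, ← zpow_add₀ h0,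
      show -(A * (A + 1)) + -(B * (B + 1)) = -((A + B) * (A + B + 1)) + A * B + A * B by ring,
      zpow_add₀ h0, zpow_add₀ h0] at h
    refine mul_left_cancel₀
      (mul_ne_zero (zpow_ne_zero (-((A + B) * (A + B + 1))) h0) (zpow_ne_zero (A * B) h0)) ?_
    linear_combination h
  · simp only [← zpow_natCast, ← zpow_mul, zero_mul, zero_add, one_mul]
    rw [← zpow_add₀ h0]
    congr 1
    push_cast
    ring
  · rw [thetaCoeff_add_one h0, add_mul _ _ (A + B + 1), zpow_add₀ h0, one_mul,
      zpow_add₀ h0 (A + B + 1)]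
    ring

end PfaffSaalschutz

section VeryWellPoised

theorem tsum_tsum_mul_baileyKernel_sub_comm (p : ℂ) {f : ℤ → ℂ} (hf : ∀ v < 0, f v = 0)
    (w : ℤ → ℂ) (a b : ℤ) :
    ∑' j, w j * ∑' v, f v * baileyKernel p (a - v) (b - v) j =
      ∑' v, f v * ∑' j, w j * baileyKernel p (a - v) (b - v) j := by
  have hs : Summable (Function.uncurry fun v j : ℤ =>
      f v * (w j * baileyKernel p (a - v) (b - v) j)) := by
    refine summable_of_ne_finset_zero (s := Icc 0 (a + b) ×ˢ Icc (-b) a) fun ⟨v, j⟩ hvj => ?_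
    simp only [mem_product, mem_Icc] at hvj
    rw [Function.uncurry_apply_pair]
    rcases lt_or_ge v 0 with hv | hv
    · rw [hf v hv, zero_mul]
    · rw [baileyKernel_eq_zero p (by omega), mul_zero, mul_zero]
  simp only [← tsum_mul_left]
  rw [← hs.tsum_comm]
  exact tsum_congr fun j => tsum_congr fun v => mul_left_comm _ _ _

/-- The quotient `(q; q)_m / (q³; q³)_m`, extended by zero to negative integers `m`. -/
noncomputable def cubicRatio (q : ℂ) (m : ℤ) : ℂ := qPoch q q m.toNat * qPochInv (q ^ 3) m

variable {q : ℂ}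

theorem cubicRatio_natCast (q : ℂ) (n : ℕ) :
    cubicRatio q n = qPoch q q n * (qPoch (q ^ 3) (q ^ 3) n)⁻¹ := by
  rw [cubicRatio, Int.toNat_natCast, qPochInv_natCast]

theorem qPochInv_mul_cubicRatio (hq : ‖q‖ < 1) (m : ℤ) :
    qPochInv q m * cubicRatio q m = qPochInv (q ^ 3) m := by
  rcases lt_or_ge m 0 with hm | hm
  · rw [qPochInv_of_neg q hm, qPochInv_of_neg _ hm, zero_mul]
  · lift m to ℕ using hm
    rw [cubicRatio, qPochInv_natCast, Int.toNat_natCast,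
      inv_mul_cancel_left₀ (qPoch_self_ne_zero hq m)]

theorem cubicRatio_succ (hq : ‖q‖ < 1) (m : ℕ) :
    (1 + q ^ (m + 1) + (q ^ (m + 1)) ^ 2) * cubicRatio q (m + 1) = cubicRatio q m := by
  have hm := one_sub_pow_succ_ne_zero (norm_pow_lt_one hq three_ne_zero) m
  have hm' := qPoch_self_ne_zero (norm_pow_lt_one hq three_ne_zero) m
  rw [← Nat.cast_succ, cubicRatio_natCast, cubicRatio_natCast, qPoch_self_succ, qPoch_self_succ]
  field_simp
  ring

theorem cubicRatio_mul_baileyKernel (h0 : q ≠ 0) (hq : ‖q‖ < 1) {N r : ℕ} (hr : r ≤ N) (d : ℕ)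
    (j : ℤ) :
    qPoch q q (2 * N + d) * (cubicRatio q (N - j) * cubicRatio q (N + d + j)) *
        baileyKernel q r (r + d) j =
      cubicRatio q (N + d + r) * vandermondeSum q (fun v => cubicRatio q (N - r + v) *
        qPoch q q (2 * N + d + v.toNat)) (r - j) (r + d + j) := by
  obtain ⟨c, rfl⟩ := Nat.exists_eq_add_of_le hr
  have h := mul_vandermondeSum_of_recurrence h0 hq (c₀ := 1) (c₁ := q ^ c) (c₂ := (q ^ c) ^ 2)
    (ρ := fun m => cubicRatio q (c + m)) (π := fun v => qPoch q q (2 * (r + c) + d + v.toNat))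
    (r - j) (r + d + j) (fun m => ?_) (fun v => ?_)
  · simp only [Int.toNat_zero, add_zero] at h
    push_cast
    rw [baileyKernel, add_sub_cancel_left, show (r : ℤ) + c - j = c + (r - j) by ring,
      show (r : ℤ) + c + d + j = c + (r + d + j) by ring,
      show (r : ℤ) + c + d + r = c + (r - j + (r + d + j)) by ring]
    exact h.symm
  · have h := cubicRatio_succ hq (c + m)
    push_cast at h
    rw [← add_assoc, ← h]
    ring
  · have hv : ((v : ℤ) + 1).toNat = v + 1 := by omega
    have hpow : q ^ ((r : ℤ) - j + (r + d + j) + 1 + v) = q ^ (2 * r + d + v + 1) := by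
      rw [← zpow_natCast]
      congr 1
      push_cast
      ring
    rw [hv, Int.toNat_natCast, ← add_assoc, qPoch_self_succ, hpow]
    ring

theorem zpow_mul_cubicRatio_mul_baileyKernel (h0 : q ≠ 0) (hq : ‖q‖ < 1) {N r : ℕ} (hr : r ≤ N)
    (d : ℕ) (j : ℤ) :
    q ^ (j * j + d * j) * (qPoch q q (2 * N + d) *
        (cubicRatio q (N - j) * cubicRatio q (N + d + j)) * baileyKernel q r (r + d) j) =
      cubicRatio q (N + d + r) * ∑' v : ℤ, q ^ ((r - v) * (r - v) + d * (r - v)) * qPochInv q v *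
        (cubicRatio q (N - r + v) * qPoch q q (2 * N + d + v.toNat)) *
          baileyKernel q (r - v) (r + d - v) j := by
  rw [cubicRatio_mul_baileyKernel h0 hq hr, mul_left_comm, vandermondeSum, ← tsum_mul_left]
  congr 2
  funext v
  have hpow : q ^ ((r - v) * (r - v) + d * (r - v)) =
      q ^ (j * j + d * j) * q ^ ((r - j - v) * (r + d + j - v)) := by
    rw [← zpow_add₀ h0]
    congr 1
    ring
  rw [vandermondeCoeff, baileyKernel, hpow, sub_right_comm _ v j, sub_add_eq_add_sub _ v j]
  ring

theorem tsum_cubicRatio_mul_baileyKernel (h0 : q ≠ 0) (hq : ‖q‖ < 1) {N r d : ℕ} (hr : r ≤ N)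
    (hd : d ≤ 1) :
    qPoch q q (2 * N + d) * ∑' j : ℤ, thetaCoeff q j * q ^ (j * j + d * j) *
        (cubicRatio q (N - j) * cubicRatio q (N + d + j)) * baileyKernel q r (r + d) j =
      qPoch q q (2 * N + d + r) * qPochInv q r * (cubicRatio q N * cubicRatio q (N + d + r)) := by
  set f : ℤ → ℂ := fun v => q ^ ((r - v) * (r - v) + d * (r - v)) * qPochInv q v *
    (cubicRatio q (N - r + v) * qPoch q q (2 * N + d + v.toNat)) with hf
  calc _ = ∑' j, thetaCoeff q j * (q ^ (j * j + d * j) * (qPoch q q (2 * N + d) *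
          (cubicRatio q (N - j) * cubicRatio q (N + d + j)) * baileyKernel q r (r + d) j)) := by
        rw [← tsum_mul_left]
        exact tsum_congr fun j => by ring
    _ = cubicRatio q (N + d + r) *
        ∑' j, thetaCoeff q j * ∑' v, f v * baileyKernel q (r - v) (r + d - v) j := by
        rw [← tsum_mul_left]
        exact tsum_congr fun j => by
          rw [zpow_mul_cubicRatio_mul_baileyKernel h0 hq hr, mul_left_comm]
    _ = cubicRatio q (N + d + r) *
        ∑' v, f v * ∑' j, thetaCoeff q j * baileyKernel q (r - v) (r + d - v) j := by
        rw [tsum_tsum_mul_baileyKernel_sub_comm q fun v hv => by simp [hf, qPochInv_of_neg q hv]]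
    _ = cubicRatio q (N + d + r) * f r := by
        simp only [add_sub_right_comm, tsum_thetaCoeff_mul_baileyKernel h0 hq hd, sub_eq_zero]
        rw [tsum_eq_single (r : ℤ) fun v hv => by rw [if_neg hv.symm, mul_zero], if_pos rfl,
          mul_one]
    _ = _ := by
        simp only [hf, sub_self, mul_zero, add_zero, zpow_zero, one_mul, sub_add_cancel,
          Int.toNat_natCast]
        ring

end VeryWellPoised

section InnerSum

theorem tsum_int_eq_sum_antidiagonal {E : Type*} [AddCommMonoid E] [TopologicalSpace E] {f : ℤ → E}
    (N : ℕ) (hf : ∀ v, v < 0 ∨ (N : ℤ) < v → f v = 0) :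
    ∑' v, f v = ∑ p ∈ antidiagonal N, f p.1 := by
  rw [Nat.sum_antidiagonal_eq_sum_range_succ_mk,
    tsum_eq_sum (s := (range N.succ).map Nat.castEmbedding), sum_map]
  · rfl
  · intro v hv
    refine hf v (by_contra fun h => hv ?_)
    simp only [Finset.mem_map, mem_range, Nat.castEmbedding_apply]
    exact ⟨v.toNat, by omega, by omega⟩

/-- The common shape of the summands of the first (`d = 1`) and third (`d = 0`) double sums. The
factors that depend only on `N = n + r` and the term `v = n` of a `q`-binomial sum are kept apart
from the closed form of a very-well-poised sum with upper parameter `r`. -/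
noncomputable def baileySummand (q : ℂ) (d n r : ℕ) : ℂ :=
  q ^ (2 * ((n + r) * (n + r) + d * (n + r))) * (thetaCoeff q n * qPochInv q n *
    (qPoch q q (2 * (n + r) + d + r) * qPochInv q r *
      (cubicRatio q (n + r) * cubicRatio q (n + r + d + r)) / qPoch q q (2 * (n + r) + d)))

variable {q : ℂ}

theorem tsum_thetaCoeff_mul_baileyKernel_sub (h0 : q ≠ 0) (hq : ‖q‖ < 1) (a b j : ℤ) :
    ∑' v, thetaCoeff q v * qPochInv q v * baileyKernel q (a - v) (b - v) j =
      q ^ ((a - j) * (b + j)) * baileyKernel q a b j := by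
  rw [baileyKernel, ← tsum_thetaCoeff_mul_qPochInv h0 hq]
  refine tsum_congr fun v => ?_
  rw [baileyKernel, sub_right_comm _ v j, sub_add_eq_add_sub, mul_assoc, mul_assoc]

theorem sum_antidiagonal_baileySummand (h0 : q ≠ 0) (hq : ‖q‖ < 1) (N : ℕ) {d : ℕ} (hd : d ≤ 1) :
    ∑ p ∈ antidiagonal N, baileySummand q d p.1 p.2 =
      (q ^ 3) ^ (N * N + d * N) * ∑' j, thetaCoeff q j * baileyKernel (q ^ 3) N (N + d) j := by
  set w : ℤ → ℂ := fun j => thetaCoeff q j * q ^ (j * j + d * j) *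
    (cubicRatio q (N - j) * cubicRatio q (N + d + j))
  set f : ℤ → ℂ := fun v => thetaCoeff q v * qPochInv q v with hf
  have hf_neg (v : ℤ) (hv : v < 0) : f v = 0 := by simp only [hf, qPochInv_of_neg q hv, mul_zero]
  have hterm {p : ℕ × ℕ} (hp : p ∈ antidiagonal N) : baileySummand q d p.1 p.2 =
      q ^ (2 * (N * N + d * N)) *
        (f p.1 * ∑' j, w j * baileyKernel q (N - p.1) (N + d - p.1) j) := by
    rw [HasAntidiagonal.mem_antidiagonal] at hp
    have hN : (N : ℤ) = p.1 + p.2 := by exact_mod_cast hp.symm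
    have h := tsum_cubicRatio_mul_baileyKernel h0 hq (show p.2 ≤ N by omega) hd
    rw [mul_comm, ← eq_div_iff (qPoch_self_ne_zero hq _)] at h
    rw [show (N : ℤ) - p.1 = p.2 by omega, show (N : ℤ) + d - p.1 = p.2 + d by omega, h,
      baileySummand, hp, hN]
  have hinner (j : ℤ) : q ^ (2 * (N * N + d * N)) *
      (w j * ∑' v, f v * baileyKernel q (N - v) (N + d - v) j) =
      (q ^ 3) ^ (N * N + d * N) * (thetaCoeff q j * baileyKernel (q ^ 3) N (N + d) j) := by
    have hpow : q ^ (j * j + d * j) * q ^ (((N : ℤ) - j) * (N + d + j)) = q ^ (N * N + d * N) := by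
      rw [← zpow_add₀ h0, ← zpow_natCast]
      congr 1
      push_cast
      ring
    rw [tsum_thetaCoeff_mul_baileyKernel_sub h0 hq, baileyKernel, baileyKernel,
      ← qPochInv_mul_cubicRatio hq (N - j), ← qPochInv_mul_cubicRatio hq (N + d + j),
      pow_right_comm, pow_mul', ← hpow]
    ring
  calc ∑ p ∈ antidiagonal N, baileySummand q d p.1 p.2
      = q ^ (2 * (N * N + d * N)) *
          ∑' v, f v * ∑' j, w j * baileyKernel q (N - v) (N + d - v) j := by
        rw [sum_congr rfl fun p hp => hterm hp, ← mul_sum, tsum_int_eq_sum_antidiagonal N]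
        rintro v (hv | hv)
        · rw [hf_neg v hv, zero_mul]
        · rw [tsum_mul_baileyKernel_of_add_neg q w (by omega), mul_zero]
    _ = _ := by
        rw [← tsum_tsum_mul_baileyKernel_sub_comm q hf_neg, ← tsum_mul_left, ← tsum_mul_left]
        exact tsum_congr hinner

end InnerSum

section BaileyLemma

variable {p : ℂ} {d : ℕ}

theorem tsum_pow_mul_qPochInv_mul_baileyKernel_sub (h0 : p ≠ 0) (hp : ‖p‖ < 1) (d : ℕ) (M j : ℤ) :
    ∑' v, p ^ ((M - v) * (M - v) + d * (M - v)) * qPochInv p v *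
        baileyKernel p (M - v) (M + d - v) j =
      p ^ (j * j + d * j) * baileyKernel p M (M + d) j := by
  rw [baileyKernel, ← tsum_vandermondeCoeff h0 hp, ← tsum_mul_left]
  refine tsum_congr fun v => ?_
  rw [vandermondeCoeff, baileyKernel, sub_right_comm _ v j, sub_add_eq_add_sub,
    ← mul_assoc (p ^ (j * j + d * j)), ← zpow_add₀ h0, mul_assoc, mul_assoc]
  congr 2
  ring

theorem tsum_qPochInv_mul_tsum_mul_baileyKernel (h0 : p ≠ 0) (hp : ‖p‖ < 1) (hd : d ≤ 1)
    (w : ℤ → ℂ) (M : ℕ) :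
    ∑' N : ℕ, qPochInv p (M - N) *
        (p ^ (N * N + d * N) * ∑' j, w j * baileyKernel p N (N + d) j) =
      ∑' j : ℤ, w j * p ^ (j * j + d * j) * baileyKernel p M (M + d) j := by
  set f : ℤ → ℂ := fun v => p ^ ((M - v) * (M - v) + d * (M - v)) * qPochInv p v with hf
  have hf_neg (v : ℤ) (hv : v < 0) : f v = 0 := by simp only [hf, qPochInv_of_neg p hv, mul_zero]
  set g : ℤ → ℂ := fun v => f v * ∑' j, w j * baileyKernel p (M - v) (M + d - v) j with hg
  have hg_supp : Function.support (fun v => g (M - v)) ⊆ Set.range ((↑) : ℕ → ℤ) := by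
    intro v hv
    refine ⟨v.toNat, Int.toNat_of_nonneg (not_lt.mp fun hlt => hv ?_)⟩
    simp only [hg]
    rw [tsum_mul_baileyKernel_of_add_neg p w (by omega), mul_zero]
  calc _ = ∑' N : ℕ, g (M - N) := by
        refine tsum_congr fun N => ?_
        simp only [hg, hf, sub_sub_cancel]
        rw [add_sub_right_comm, sub_sub_cancel, mul_comm (_ ^ _ : ℂ) (qPochInv _ _), mul_assoc]
        norm_cast
    _ = ∑' v, g v := by
        rw [Nat.cast_injective.tsum_eq hg_supp, ← (Equiv.subLeft (M : ℤ)).tsum_eq g]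
        rfl
    _ = _ := by
        rw [← tsum_tsum_mul_baileyKernel_sub_comm p hf_neg]
        simp only [hf, tsum_pow_mul_qPochInv_mul_baileyKernel_sub h0 hp]
        simp only [mul_assoc]

theorem tendsto_tsum_qPochInv_sub_mul (hp : ‖p‖ < 1) {c : ℕ → ℂ} (hc : Summable fun N => ‖c N‖) :
    Tendsto (fun M : ℕ => ∑' N : ℕ, qPochInv p (M - N) * c N) atTop
      (𝓝 ((qPochInf p p)⁻¹ * ∑' N, c N)) := by
  obtain ⟨C, hC⟩ := exists_norm_qPochInv_le hp
  rw [← tsum_mul_left]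
  refine tendsto_tsum_of_dominated_convergence (hc.mul_left C)
    (fun N => (tendsto_qPochInv_add hp (-N)).mul_const _) (.of_forall fun M N => ?_)
  rw [norm_mul]
  exact mul_le_mul_of_nonneg_right (hC _) (norm_nonneg _)

theorem mul_self_add_mul_nonneg (hd : d ≤ 1) (j : ℤ) : 0 ≤ j * j + d * j := by
  have : (d : ℤ) ≤ 1 := by exact_mod_cast hd
  rcases le_or_gt 0 j with hj | hj
  · positivity
  · nlinarith

theorem norm_mul_zpow_mul_self_le (hp : ‖p‖ < 1) (hd : d ≤ 1) (z : ℂ) (j : ℤ) :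
    ‖z * p ^ (j * j + d * j)‖ ≤ ‖z‖ := by
  lift j * j + d * j to ℕ using mul_self_add_mul_nonneg hd j with k
  rw [norm_mul, norm_zpow, zpow_natCast]
  exact mul_le_of_le_one_right (norm_nonneg z) (pow_le_one₀ (norm_nonneg p) hp.le)

theorem tsum_pow_mul_tsum_mul_baileyKernel (h0 : p ≠ 0) (hp : ‖p‖ < 1) (hd : d ≤ 1)
    {w : ℤ → ℂ} (hw : Summable fun j => ‖w j‖) :
    ∑' N : ℕ, p ^ (N * N + d * N) * ∑' j, w j * baileyKernel p N (N + d) j =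
      (∑' j : ℤ, w j * p ^ (j * j + d * j)) / qPochInf p p := by
  have hP := qPochInf_self_ne_zero hp
  obtain ⟨C, hC⟩ := exists_norm_baileyKernel_le hp
  have hβ (N : ℕ) : ‖∑' j, w j * baileyKernel p N (N + d) j‖ ≤ ∑' j, ‖w j‖ * C := by
    refine tsum_of_norm_bounded (hw.mul_right C).hasSum fun j => ?_
    rw [norm_mul]
    exact mul_le_mul_of_nonneg_left (hC _ _ _) (norm_nonneg _)
  have hpow (N : ℕ) : ‖p ^ (N * N + d * N)‖ ≤ ‖p‖ ^ N := by
    rw [norm_pow]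
    exact pow_le_pow_of_le_one (norm_nonneg p) hp.le (le_add_right (Nat.le_mul_self N))
  have hleft := tendsto_tsum_qPochInv_sub_mul hp (c := fun N =>
      p ^ (N * N + d * N) * ∑' j, w j * baileyKernel p N (N + d) j) <|
    .of_nonneg_of_le (fun _ => norm_nonneg _) (fun N => (norm_mul_le _ _).trans
      (mul_le_mul (hpow N) (hβ N) (norm_nonneg _) (pow_nonneg (norm_nonneg p) N)))
      ((summable_geometric_of_lt_one (norm_nonneg p) hp).mul_right _)
  have hright := tendsto_tsum_mul_baileyKernel hp d <|
    hw.of_nonneg_of_le (fun _ => norm_nonneg _) fun j => norm_mul_zpow_mul_self_le hp hd (w j) j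
  simp only [tsum_qPochInv_mul_tsum_mul_baileyKernel h0 hp hd] at hleft
  have h := tendsto_nhds_unique hleft hright
  rw [mul_left_comm] at h
  exact (mul_left_cancel₀ (inv_ne_zero hP) h).trans (div_eq_mul_inv _ _).symm

end BaileyLemma

section Summands

variable {q : ℂ}

theorem sq_eq_add_two_mul_choose_two (n : ℕ) : n ^ 2 = n + 2 * n.choose 2 := by
  rw [Nat.choose_two_right, Nat.mul_div_cancel' (Nat.even_mul_pred_self n).two_dvd]
  cases n with
  | zero => rfl
  | succ k => rw [Nat.add_sub_cancel]; ring

theorem thetaCoeff_natCast (q : ℂ) (n : ℕ) : thetaCoeff q n = (-1) ^ n * q ^ n.choose 2 := by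
  have h : (n : ℤ) * (n - 1) / 2 = n.choose 2 := by
    have hn : (n : ℤ) ^ 2 = n + 2 * n.choose 2 := by exact_mod_cast sq_eq_add_two_mul_choose_two n
    rw [show (n : ℤ) * (n - 1) = 2 * n.choose 2 by linear_combination hn]
    exact Int.mul_ediv_cancel_left _ two_ne_zero
  rw [thetaCoeff, h, zpow_natCast, zpow_natCast]

theorem summand₁_eq_baileySummand (q : ℂ) (n r : ℕ) : summand₁ q n r = baileySummand q 1 n r := by
  have hn := sq_eq_add_two_mul_choose_two n
  have hexp : (5 * n ^ 2 + 3 * n) / 2 + 4 * n * r + 2 * r ^ 2 + 2 * r =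
      2 * ((n + r) * (n + r) + 1 * (n + r)) + n.choose 2 := by
    rw [show (5 * n ^ 2 + 3 * n) / 2 = 2 * n ^ 2 + 2 * n + n.choose 2 by omega]
    ring
  rw [baileySummand, thetaCoeff_natCast, qPochInv_natCast, qPochInv_natCast]
  norm_cast
  rw [cubicRatio_natCast, cubicRatio_natCast, summand₁, hexp, pow_add,
    show 2 * (n + r) + 1 + r = 2 * n + 3 * r + 1 by ring,
    show n + r + 1 + r = n + 2 * r + 1 by ring,
    show 2 * (n + r) + 1 = 2 * n + 2 * r + 1 by ring, div_eq_mul_inv, div_eq_mul_inv]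
  simp only [mul_inv]
  push_cast
  ring

theorem summand₃_eq_baileySummand (q : ℂ) (n r : ℕ) : summand₃ q n r = baileySummand q 0 n r := by
  have hn := sq_eq_add_two_mul_choose_two n
  have hexp : (5 * n ^ 2 - n) / 2 + 4 * n * r + 2 * r ^ 2 =
      2 * ((n + r) * (n + r) + 0 * (n + r)) + n.choose 2 := by
    rw [show (5 * n ^ 2 - n) / 2 = 2 * n ^ 2 + n.choose 2 by omega]
    ring
  rw [baileySummand, thetaCoeff_natCast, qPochInv_natCast, qPochInv_natCast]
  norm_cast
  rw [cubicRatio_natCast, cubicRatio_natCast, summand₃, hexp, pow_add,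
    show 2 * (n + r) + 0 + r = 2 * n + 3 * r by ring, show n + r + 0 + r = n + 2 * r by ring,
    show 2 * (n + r) + 0 = 2 * n + 2 * r by ring, div_eq_mul_inv, div_eq_mul_inv]
  simp only [mul_inv]
  push_cast
  ring

theorem summand₂_eq_mul_summand₁ (hq : ‖q‖ < 1) (n r : ℕ) :
    summand₂ q n r = q ^ (3 * (n + r) + 2) / (1 - (q ^ 3) ^ (n + r + 1)) * summand₁ q n r := by
  have hp := norm_pow_lt_one hq three_ne_zero
  have hexp : (5 * n ^ 2 + 9 * n) / 2 + 4 * n * r + 2 * r ^ 2 + 5 * r + 2 =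
      3 * (n + r) + 2 + ((5 * n ^ 2 + 3 * n) / 2 + 4 * n * r + 2 * r ^ 2 + 2 * r) := by
    omega
  have hfactor : 1 - q ^ (2 * n + 2 * r + 1 + 1) =
      (1 - q ^ (n + r + 1)) * (1 + q ^ (n + r + 1)) := by ring
  have hne := one_sub_pow_succ_ne_zero hq (2 * n + 2 * r + 1)
  rw [hfactor, mul_ne_zero_iff] at hne
  obtain ⟨hsub, hadd⟩ := hne
  have hcube := one_sub_pow_succ_ne_zero hp (n + r)
  have hden₁ := qPoch_self_ne_zero hq n
  have hden₂ := qPoch_self_ne_zero hq r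
  have hden₃ := qPoch_self_ne_zero hq (2 * n + 2 * r + 1)
  have hden₄ := qPoch_self_ne_zero hp (n + r)
  have hden₅ := qPoch_self_ne_zero hp (n + 2 * r + 1)
  rw [summand₂, summand₁, hexp, pow_add, qPoch_self_succ q (n + r), qPoch_self_succ (q ^ 3) (n + r),
    qPoch_self_succ q (2 * n + 2 * r + 1), hfactor]
  field_simp

theorem exists_norm_cubicRatio_le (hq : ‖q‖ < 1) : ∃ C : ℝ, ∀ m, ‖cubicRatio q m‖ ≤ C := by
  obtain ⟨A, hA⟩ := exists_norm_qPoch_le q hq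
  obtain ⟨B, hB⟩ := exists_norm_qPochInv_le (norm_pow_lt_one hq three_ne_zero)
  refine ⟨A * B, fun m => ?_⟩
  rw [cubicRatio, norm_mul]
  exact mul_le_mul (hA _) (hB _) (norm_nonneg _) ((norm_nonneg _).trans (hA 0))

theorem exists_norm_baileySummand_le (hq : ‖q‖ < 1) (d : ℕ) :
    ∃ K : ℝ, ∀ n r, ‖baileySummand q d n r‖ ≤ ‖q‖ ^ (n + r) * K := by
  obtain ⟨A, hA⟩ := exists_norm_qPoch_le q hq
  obtain ⟨B, hB⟩ := exists_norm_qPochInv_le hq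
  obtain ⟨C, hC⟩ := exists_norm_cubicRatio_le hq
  have hA0 : 0 ≤ A := (norm_nonneg _).trans (hA 0)
  have hB0 : 0 ≤ B := (norm_nonneg _).trans (hB 0)
  have hC0 : 0 ≤ C := (norm_nonneg _).trans (hC 0)
  refine ⟨1 * B * (A * B * (C * C) * B), fun n r => ?_⟩
  have hpow : ‖q‖ ^ (2 * ((n + r) * (n + r) + d * (n + r))) ≤ ‖q‖ ^ (n + r) :=
    pow_le_pow_of_le_one (norm_nonneg q) hq.le (by nlinarith [Nat.le_mul_self (n + r)])
  rw [baileySummand, div_eq_mul_inv, ← qPochInv_natCast]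
  simp only [norm_mul, norm_pow]
  gcongr
  exacts [norm_thetaCoeff_le_one hq _, hB _, hA _, hB _, hC _, hC _, hB _]

theorem summable_baileySummand (hq : ‖q‖ < 1) (d : ℕ) :
    Summable fun p : ℕ × ℕ => baileySummand q d p.1 p.2 := by
  obtain ⟨K, hK⟩ := exists_norm_baileySummand_le hq d
  have hgeom := summable_geometric_of_lt_one (norm_nonneg q) hq
  have hprod : Summable fun p : ℕ × ℕ => ‖q‖ ^ p.1 * ‖q‖ ^ p.2 :=
    hgeom.mul_of_nonneg hgeom (fun _ => pow_nonneg (norm_nonneg q) _)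
      fun _ => pow_nonneg (norm_nonneg q) _
  refine Summable.of_norm_bounded (hprod.mul_right K) fun p => ?_
  rw [← pow_add]
  exact hK _ _

theorem summable_summand₁ (hq : ‖q‖ < 1) : Summable fun p : ℕ × ℕ => summand₁ q p.1 p.2 := by
  simpa only [summand₁_eq_baileySummand] using summable_baileySummand hq 1

theorem summable_summand₃ (hq : ‖q‖ < 1) : Summable fun p : ℕ × ℕ => summand₃ q p.1 p.2 := by
  simpa only [summand₃_eq_baileySummand] using summable_baileySummand hq 0

theorem summable_summand₂ (hq : ‖q‖ < 1) : Summable fun p : ℕ × ℕ => summand₂ q p.1 p.2 := by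
  refine Summable.of_norm_bounded ((summable_summand₁ hq).norm.mul_left (1 / (1 - ‖q‖)))
    fun p => ?_
  have hden : 1 - ‖q‖ ≤ ‖1 - (q ^ 3) ^ (p.1 + p.2 + 1)‖ := by
    refine le_trans ?_ (norm_sub_norm_le _ _)
    rw [norm_one, ← pow_mul, norm_pow]
    gcongr
    exact pow_le_of_le_one (norm_nonneg q) hq.le (by omega)
  rw [summand₂_eq_mul_summand₁ hq, norm_mul, norm_div, norm_pow]
  have := sub_pos.mpr hq
  gcongr
  exact pow_le_one₀ (norm_nonneg q) hq.le

end Summands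

section SecondSum

variable {q : ℂ}

theorem thetaCoeff_mul_zpow_two_mul_neg_one_sub (h0 : q ≠ 0) (j : ℤ) :
    thetaCoeff q (-1 - j) * q ^ (2 * (-1 - j)) = -q⁻¹ * thetaCoeff q j := by
  have hj : q ^ j ≠ 0 := zpow_ne_zero _ h0
  rw [show -1 - j = -(j + 1) by ring, thetaCoeff_neg h0, thetaCoeff_add_one h0,
    show 2 * -(j + 1) = -(j + 1) + -(j + 1) by ring, zpow_add₀ h0 (-(j + 1)), zpow_neg,
    zpow_add_one₀ h0]
  field_simp

theorem tsum_thetaCoeff_mul_zpow_two_mul_mul_baileyKernel (h0 : q ≠ 0) (p : ℂ) (M : ℤ) :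
    ∑' j : ℤ, thetaCoeff q j * q ^ (2 * j) * baileyKernel p M (M + 1) j =
      -q⁻¹ * ∑' j : ℤ, thetaCoeff q j * baileyKernel p M (M + 1) j := by
  rw [← (Equiv.subLeft (-1 : ℤ)).tsum_eq, ← tsum_mul_left]
  refine tsum_congr fun j => ?_
  rw [Equiv.subLeft_apply, thetaCoeff_mul_zpow_two_mul_neg_one_sub h0, baileyKernel, baileyKernel,
    show M - (-1 - j) = M + 1 + j by ring, show M + 1 + (-1 - j) = M - j by ring]
  ring

theorem one_sub_mul_tsum_thetaCoeff_mul_zpow_two_mul_mul_baileyKernel (h0 : q ≠ 0) (hq : ‖q‖ < 1)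
    (M : ℕ) :
    (1 - (q ^ 3) ^ (M + 1)) *
        ∑' j : ℤ, thetaCoeff q j * q ^ (2 * j) * baileyKernel (q ^ 3) (M + 1) (M + 1) j =
      ∑' j : ℤ, thetaCoeff q j * q ^ (2 * j) * baileyKernel (q ^ 3) M (M + 1) j := by
  have hp := norm_pow_lt_one hq three_ne_zero
  have hp0 := pow_ne_zero 3 h0
  set P := (q ^ 3) ^ (M + 1) with hP
  set A : ℤ → ℂ := fun j => thetaCoeff q j * q ^ (2 * j) * baileyKernel (q ^ 3) (M + 1) (M + 1) j
    with hA
  set B : ℤ → ℂ := fun j => thetaCoeff q j * q ^ (2 * j) * baileyKernel (q ^ 3) M (M + 1) j with hB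
  have hBs : Summable B := summable_mul_baileyKernel _ _ _ _
  have hBs' : Summable fun j => B (-j) := (Equiv.neg ℤ).summable_iff.mpr hBs
  have hAB (j : ℤ) : (1 - P * P) * A j = B j + P * B (-j) := by
    have hK := one_sub_zpow_mul_baileyKernel hp0 hp (M + 1) (M + 1) j
    have hj : q ^ j ≠ 0 := zpow_ne_zero _ h0
    have hcube : (q ^ 3) ^ j = (q ^ j) ^ 3 := by
      rw [← zpow_natCast, ← zpow_natCast, zpow_comm]
    have hsq : q ^ (2 * j) = (q ^ j) ^ 2 := by rw [mul_comm, zpow_mul, zpow_ofNat]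
    rw [zpow_add₀ hp0, zpow_sub₀ hp0, ← Nat.cast_succ, zpow_natCast, ← hP, hcube, Nat.cast_succ,
      add_sub_cancel_right] at hK
    simp only [hA, hB]
    rw [mul_left_comm, hK, baileyKernel_neg, thetaCoeff_neg h0, mul_neg, zpow_neg, hsq]
    field_simp
  have hBneg : ∑' j, B (-j) = ∑' j, B j := (Equiv.neg ℤ).tsum_eq B
  have hP1 : 1 + P ≠ 0 := by
    have h := one_sub_pow_succ_ne_zero hp (2 * M + 1)
    rw [show 1 - (q ^ 3) ^ (2 * M + 1 + 1) = (1 - P) * (1 + P) by rw [hP]; ring] at h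
    exact right_ne_zero_of_mul h
  refine mul_left_cancel₀ hP1 ?_
  calc (1 + P) * ((1 - P) * ∑' j, A j) = ∑' j, (1 - P * P) * A j := by rw [tsum_mul_left]; ring
    _ = ∑' j, B j + P * ∑' j, B j := by
      rw [tsum_congr hAB, hBs.tsum_add (hBs'.mul_left _), tsum_mul_left, hBneg]
    _ = (1 + P) * ∑' j, B j := by ring

theorem sum_antidiagonal_summand₂ (h0 : q ≠ 0) (hq : ‖q‖ < 1) (M : ℕ) :
    ∑ p ∈ antidiagonal M, summand₂ q p.1 p.2 = -((q ^ 3) ^ ((M + 1) * (M + 1)) *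
      ∑' j : ℤ, thetaCoeff q j * q ^ (2 * j) * baileyKernel (q ^ 3) (M + 1) (M + 1) j) := by
  have hcube := one_sub_pow_succ_ne_zero (norm_pow_lt_one hq three_ne_zero) M
  have htheta := (one_sub_mul_tsum_thetaCoeff_mul_zpow_two_mul_mul_baileyKernel h0 hq M).trans
    (tsum_thetaCoeff_mul_zpow_two_mul_mul_baileyKernel h0 (q ^ 3) M)
  have hsum : ∑ p ∈ antidiagonal M, summand₂ q p.1 p.2 =
      q ^ (3 * M + 2) / (1 - (q ^ 3) ^ (M + 1)) *
        ∑ p ∈ antidiagonal M, baileySummand q 1 p.1 p.2 := by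
    rw [mul_sum]
    refine sum_congr rfl fun p hp => ?_
    rw [summand₂_eq_mul_summand₁ hq, summand₁_eq_baileySummand, mem_antidiagonal.mp hp]
  rw [hsum, sum_antidiagonal_baileySummand h0 hq M le_rfl, Nat.cast_one]
  refine mul_left_cancel₀ hcube ?_
  rw [mul_neg, mul_left_comm _ ((q ^ 3) ^ ((M + 1) * (M + 1))), htheta]
  field_simp
  ring

end SecondSum

section DoubleSums

variable {q : ℂ}

theorem tsum_prod_eq_tsum_sum_antidiagonal {E : Type*} [AddCommMonoid E] [TopologicalSpace E]
    [ContinuousAdd E] [T3Space E] {f : ℕ × ℕ → E} (hf : Summable f) :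
    ∑' p, f p = ∑' N, ∑ p ∈ antidiagonal N, f p := by
  conv_rhs => congr; ext; rw [← sum_finset_coe, ← tsum_fintype (L := .unconditional _)]
  rw [← HasAntidiagonal.sigmaAntidiagonalEquivProd.tsum_eq f]
  exact (HasAntidiagonal.sigmaAntidiagonalEquivProd.summable_iff.mpr hf).tsum_sigma'
    fun n => (hasSum_fintype _).summable

theorem summable_sum_antidiagonal {E : Type*} [AddCommMonoid E] [TopologicalSpace E]
    [ContinuousAdd E] [RegularSpace E] {f : ℕ × ℕ → E} (hf : Summable f) :
    Summable fun N => ∑ p ∈ antidiagonal N, f p := by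
  conv => congr; ext; rw [← sum_finset_coe, ← tsum_fintype (L := .unconditional _)]
  exact (HasAntidiagonal.sigmaAntidiagonalEquivProd.summable_iff.mpr hf).sigma'
    fun n => (hasSum_fintype _).summable

theorem tsum_thetaCoeff_mul_zpow_mul_zpow_mul_self (h0 : q ≠ 0) (hq : ‖q‖ < 1) (m : ℕ) {x : ℂ}
    (hx : x ≠ 0) :
    ∑' j : ℤ, thetaCoeff q j * x ^ j * (q ^ m) ^ (j * j) =
      qPochInf₃ (q ^ m * x) (q ^ (m + 1) / x) (q ^ (2 * m + 1)) (q ^ (2 * m + 1)) := by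
  have hm0 : q ^ m ≠ 0 := pow_ne_zero m h0
  have hdiv : q ^ (2 * m + 1) / (q ^ m * x) = q ^ (m + 1) / x := by
    field_simp
    ring
  rw [qPochInf₃, ← hdiv, ← tsum_thetaCoeff_mul_zpow (pow_ne_zero (2 * m + 1) h0)
    (norm_pow_lt_one hq (Nat.succ_ne_zero (2 * m))) (mul_ne_zero hm0 hx)]
  refine tsum_congr fun j => ?_
  rw [thetaCoeff_pow_two_mul_add_one h0, mul_zpow, zpow_mul q m, zpow_natCast,
    zpow_sub₀ hm0]
  field_simp

theorem tsum_thetaCoeff_mul_zpow_mul_baileyKernel_cube (h0 : q ≠ 0) (hq : ‖q‖ < 1) {d : ℕ}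
    (hd : d ≤ 1) {x : ℂ} (hx : x ≠ 0) :
    ∑' N : ℕ, (q ^ 3) ^ (N * N + d * N) *
        ∑' j : ℤ, thetaCoeff q j * x ^ j * baileyKernel (q ^ 3) N (N + d) j =
      qPochInf₃ (q ^ 3 * ((q ^ 3) ^ d * x)) (q ^ 4 / ((q ^ 3) ^ d * x)) (q ^ 7) (q ^ 7) /
        qPochInf (q ^ 3) (q ^ 3) := by
  have hp0 : q ^ 3 ≠ 0 := pow_ne_zero 3 h0
  rw [tsum_pow_mul_tsum_mul_baileyKernel hp0 (norm_pow_lt_one hq three_ne_zero) hd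
    (summable_norm_thetaCoeff_mul_zpow h0 hq hx),
    ← tsum_thetaCoeff_mul_zpow_mul_zpow_mul_self h0 hq 3 (mul_ne_zero (pow_ne_zero d hp0) hx)]
  congr 1
  refine tsum_congr fun j => ?_
  rw [zpow_add₀ hp0, zpow_mul (q ^ 3) d, zpow_natCast, mul_zpow]
  ring

theorem tsum_baileySummand (h0 : q ≠ 0) (hq : ‖q‖ < 1) {d : ℕ} (hd : d ≤ 1) :
    ∑' p : ℕ × ℕ, baileySummand q d p.1 p.2 =
      qPochInf₃ (q ^ 3 * (q ^ 3) ^ d) (q ^ 4 / (q ^ 3) ^ d) (q ^ 7) (q ^ 7) /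
        qPochInf (q ^ 3) (q ^ 3) := by
  rw [tsum_prod_eq_tsum_sum_antidiagonal (summable_baileySummand hq d),
    tsum_congr fun N => sum_antidiagonal_baileySummand h0 hq N hd]
  simpa using tsum_thetaCoeff_mul_zpow_mul_baileyKernel_cube h0 hq hd one_ne_zero

theorem baileySummand_zero_of_ne (d : ℕ) {p : ℕ × ℕ} (hp : p ≠ 0) :
    baileySummand 0 d p.1 p.2 = 0 := by
  obtain ⟨K, hK⟩ := exists_norm_baileySummand_le (q := 0) (by simp) d
  have hne : p.1 + p.2 ≠ 0 := fun h =>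
    hp (Prod.ext (Nat.add_eq_zero_iff.mp h).1 (Nat.add_eq_zero_iff.mp h).2)
  simpa [zero_pow hne] using hK p.1 p.2

theorem tsum_baileySummand_zero (d : ℕ) : ∑' p : ℕ × ℕ, baileySummand 0 d p.1 p.2 = 1 := by
  rw [tsum_eq_single 0 fun p hp => baileySummand_zero_of_ne d hp]
  simp [baileySummand, qPoch, thetaCoeff_zero, qPochInv_zero, qPochInv_natCast, cubicRatio]

theorem qPochInf₃_swap (a b c q : ℂ) : qPochInf₃ a b c q = qPochInf₃ b a c q := by
  rw [qPochInf₃, qPochInf₃, mul_comm (qPochInf a q)]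

theorem tsum_summand₁ (hq : ‖q‖ < 1) :
    ∑' p : ℕ × ℕ, summand₁ q p.1 p.2 =
      qPochInf₃ q (q ^ 6) (q ^ 7) (q ^ 7) / qPochInf (q ^ 3) (q ^ 3) := by
  simp only [summand₁_eq_baileySummand]
  rcases eq_or_ne q 0 with rfl | h0
  · simp [tsum_baileySummand_zero, qPochInf₃, qPochInf_zero_left]
  rw [tsum_baileySummand h0 hq le_rfl, qPochInf₃_swap q, pow_one, ← pow_add,
    show q ^ 4 / q ^ 3 = q by field_simp]

theorem one_sub_tsum_summand₂_eq_tsum (h0 : q ≠ 0) (hq : ‖q‖ < 1) :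
    1 - ∑' p : ℕ × ℕ, summand₂ q p.1 p.2 =
      ∑' N : ℕ, (q ^ 3) ^ (N * N) *
        ∑' j : ℤ, thetaCoeff q j * q ^ (2 * j) * baileyKernel (q ^ 3) N N j := by
  set f : ℕ → ℂ := fun N => (q ^ 3) ^ (N * N) *
    ∑' j : ℤ, thetaCoeff q j * q ^ (2 * j) * baileyKernel (q ^ 3) N N j with hf
  have hzero : f 0 = 1 := by
    simp only [hf, Nat.cast_zero, tsum_mul_baileyKernel_zero]
    simp [thetaCoeff_zero]
  have hsucc (M : ℕ) : -∑ p ∈ antidiagonal M, summand₂ q p.1 p.2 = f (M + 1) := by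
    rw [sum_antidiagonal_summand₂ h0 hq, neg_neg]
    simp only [hf, Nat.cast_succ]
  have hsummable : Summable f := by
    rw [← summable_nat_add_iff 1]
    exact (summable_sum_antidiagonal (summable_summand₂ hq)).neg.congr hsucc
  rw [hsummable.tsum_eq_zero_add, hzero, ← tsum_congr hsucc, tsum_neg,
    ← tsum_prod_eq_tsum_sum_antidiagonal (summable_summand₂ hq), sub_eq_add_neg]

theorem one_sub_tsum_summand₂ (hq : ‖q‖ < 1) :
    1 - ∑' p : ℕ × ℕ, summand₂ q p.1 p.2 =
      qPochInf₃ (q ^ 2) (q ^ 5) (q ^ 7) (q ^ 7) / qPochInf (q ^ 3) (q ^ 3) := by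
  rcases eq_or_ne q 0 with rfl | h0
  · simp [summand₂_eq_mul_summand₁, qPochInf₃, qPochInf_zero_left]
  have h := tsum_thetaCoeff_mul_zpow_mul_baileyKernel_cube h0 hq zero_le_one (pow_ne_zero 2 h0)
  rw [pow_zero, one_mul, ← pow_add, show q ^ 4 / q ^ 2 = q ^ 2 by field_simp,
    qPochInf₃_swap] at h
  rw [one_sub_tsum_summand₂_eq_tsum h0 hq, ← h]
  simp [zpow_mul]

theorem tsum_summand₃ (hq : ‖q‖ < 1) :
    ∑' p : ℕ × ℕ, summand₃ q p.1 p.2 =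
      qPochInf₃ (q ^ 3) (q ^ 4) (q ^ 7) (q ^ 7) / qPochInf (q ^ 3) (q ^ 3) := by
  simp only [summand₃_eq_baileySummand]
  rcases eq_or_ne q 0 with rfl | h0
  · simp [tsum_baileySummand_zero, qPochInf₃, qPochInf_zero_left]
  rw [tsum_baileySummand h0 hq zero_le_one, pow_zero, mul_one, div_one]

end DoubleSums

theorem mainTheorem5 (q : ℂ) (hq : ‖q‖ < 1) :
    (Summable (fun p : ℕ × ℕ => summand₁ q p.1 p.2) ∧
      ∑' p : ℕ × ℕ, summand₁ q p.1 p.2 =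
        qPochInf₃ q (q ^ 6) (q ^ 7) (q ^ 7) / qPochInf (q ^ 3) (q ^ 3)) ∧
    (Summable (fun p : ℕ × ℕ => summand₂ q p.1 p.2) ∧
      1 - ∑' p : ℕ × ℕ, summand₂ q p.1 p.2 =
        qPochInf₃ (q ^ 2) (q ^ 5) (q ^ 7) (q ^ 7) / qPochInf (q ^ 3) (q ^ 3)) ∧
    (Summable (fun p : ℕ × ℕ => summand₃ q p.1 p.2) ∧
      ∑' p : ℕ × ℕ, summand₃ q p.1 p.2 =
        qPochInf₃ (q ^ 3) (q ^ 4) (q ^ 7) (q ^ 7) / qPochInf (q ^ 3) (q ^ 3)) :=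
  ⟨⟨summable_summand₁ hq, tsum_summand₁ hq⟩,
    ⟨summable_summand₂ hq, one_sub_tsum_summand₂ hq⟩,
    ⟨summable_summand₃ hq, tsum_summand₃ hq⟩⟩
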